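/- Let $G=(\mathcal V,\mathcal E)$ be a finite simple graph with $V=|\mathcal V|\ge 1$ vertices (the characteristic graph of a source $X_1$), and let $X_1$ be uniformly distributed on $\mathcal V$. For $n\ge 0$ let $G^n$ be the $n$-fold OR product: its vertices are the $n$-tuples of vertices of $G$, and two distinct tuples are adjacent iff they are adjacent in $G$ in at least one coordinate ($G^0$ is a single vertex). An MIS is a maximal independent set, and $|\mathrm{MIS}_{G^t}|$ denotes the largest cardinality of an MIS of $G^t$ (so $|\mathrm{MIS}_{G^0}|=1$). Körner's graph entropy is $$H_G(X_1)=\min_{X_1\in U_1\in \mathrm{MIS}(G)} I(X_1;U_1),$$ the minimum over all joint distributions $p(x_1,u_1)$, with $X_1$ having the given law, such that $p(x_1,u_1)>0$ implies that $u_1$ is an MIS of $G$ containing $x_1$. Entropies are in bits. Let $n\ge 1$ and consider any valid coloring of $G^n$ by MISs of its sub-graphs $G^t$, $0\le t\le n$: every color class is assigned a level $t\in\{0,\dots,n\}$ and is the copy, inside an induced sub-graph of $G^n$ isomorphic to $G^t$, of an MIS of $G^t$ of cardinality $|\mathrm{MIS}_{G^t}|$. Let $\alpha_t$ be the number of color classes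 of level $t$. Then $\sum_{t=0}^n \alpha_t\,|\mathrm{MIS}_{G^t}|/V^n=1$; the entropy of the color of a uniformly distributed vertex of $G^n$ equals $$H\Big(\alpha_n\cdot\tfrac{|\mathrm{MIS}_{G^n}|}{V^n},\ \alpha_{n-1}\cdot\tfrac{|\mathrm{MIS}_{G^{n-1}}|}{V^n},\ \dots,\ \alpha_0\cdot\tfrac1{V^n}\Big),$$ the Shannon entropy of the distribution in which, for each $t$, the probability $|\mathrm{MIS}_{G^t}|/V^n$ occurs $\alpha_t$ times; and $$H_G(X_1)\ \le\ \frac1n\,H\Big(\alpha_n\cdot\tfrac{|\mathrm{MIS}_{G^n}|}{V^n},\ \alpha_{n-1}\cdot\tfrac{|\mathrm{MIS}_{G^{n-1}}|}{V^n},\ \dots,\ \alpha_0\cdot\tfrac1{V^n}\Big).$$ -/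

import Mathlib

open scoped BigOperators

namespace CharGraph

/-- The `n`-fold OR product `G^n`: vertices are `n`-tuples of vertices of `G`, and two distinct tuples
are adjacent when they are adjacent in `G` in at least one coordinate. -/
def orPower {V : Type*} (G : SimpleGraph V) (n : ℕ) : SimpleGraph (Fin n → V) where
  Adj x y := x ≠ y ∧ ∃ k, G.Adj (x k) (y k)
  symm := ⟨fun _ _ h => ⟨h.1.symm, h.2.imp fun _ hk => hk.symm⟩⟩
  loopless := ⟨fun _ h => h.1 rfl⟩

/-- A maximal independent set (MIS) of `G`: an independent set that is not properly contained in
another one. -/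
def IsMIS {V : Type*} (G : SimpleGraph V) (S : Finset V) : Prop :=
  Maximal G.IsIndepSet (S : Set V)

/-- Shannon entropy, in bits, of a finite family of probabilities. -/
noncomputable def entropy {ι : Type*} [Fintype ι] (p : ι → ℝ) : ℝ :=
  -∑ i, p i * Real.logb 2 (p i)

/-- Mutual information `I(A; B)`, in bits, of a joint distribution `p(a, b)` on finite sets. -/
noncomputable def mutualInfo {A B : Type*} [Fintype A] [Fintype B] (p : A → B → ℝ) : ℝ :=
  ∑ a, ∑ b, p a b * Real.logb 2 (p a b / ((∑ b', p a b') * (∑ a', p a' b)))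

/-- Joint distributions `p(x, u)` of a source letter `X` with law `P` and a random maximal
independent set `U` of `G` such that `X ∈ U`, i.e. `p(x, u) > 0` implies that `u` is an MIS
containing `x`. -/
structure IsAdmissible {V : Type*} [Fintype V] (G : SimpleGraph V) (P : V → ℝ)
    (p : V → Finset V → ℝ) : Prop where
  nonneg : ∀ x u, 0 ≤ p x u
  marginal : ∀ x, ∑ u, p x u = P x
  support : ∀ x u, 0 < p x u → IsMIS G u ∧ x ∈ u

/-- Körner's graph entropy `H_G(X)`, the minimum of `I(X; U)` over `X ∈ U ∈ MIS(G)`, where `X` has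
law `P` on the vertices of `G`. -/
noncomputable def graphEntropy {V : Type*} [Fintype V] (G : SimpleGraph V) (P : V → ℝ) : ℝ :=
  sInf {I : ℝ | ∃ p, IsAdmissible G P p ∧ mutualInfo p = I}

/-- The uniform distribution on a finite set. -/
noncomputable def uniform (V : Type*) [Fintype V] : V → ℝ :=
  fun _ => 1 / (Fintype.card V : ℝ)

open Classical in
/-- The distribution of the color of `(X_1, …, X_n)`, for an i.i.d. sequence with law `P` and a
coloring `c` of the `n`-tuples. -/
noncomputable def colorDist {V C : Type*} [Fintype V] {n : ℕ} (P : V → ℝ) (c : (Fin n → V) → C) :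
    C → ℝ :=
  fun k => ∑ x with c x = k, ∏ i, P (x i)

/-- A valid coloring of `G^n` by MISs of its sub-graphs `G^t`, `0 ≤ t ≤ n`. Each color `k` has a
level `t`, and its color class is the copy, inside some sub-graph of `G^n` isomorphic to `G^t`
(for instance one obtained by fixing `n - t` coordinates), of an MIS of `G^t` that has the largest
possible cardinality `(orPower G t).indepNum`. A class of level `0` is a single vertex. -/
structure MISColoring {V : Type*} (G : SimpleGraph V) (n : ℕ) (C : Type*) where
  coloring : (orPower G n).Coloring C
  level : C → Fin (n + 1)
  colorClass_eq : ∀ k : C, ∃ (e : orPower G (level k) ↪g orPower G n)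
    (S : Finset (Fin (level k) → V)), IsMIS (orPower G (level k)) S ∧
      S.card = (orPower G (level k)).indepNum ∧ coloring.colorClass k = e '' S

open Classical in
/-- `α_t`: the number of color classes that are MISs of a sub-graph `G^t`. -/
noncomputable def MISColoring.alpha {V C : Type*} [Fintype C] {G : SimpleGraph V} {n : ℕ}
    (c : MISColoring G n C) (t : Fin (n + 1)) : ℕ :=
  (Finset.univ.filter fun k : C => c.level k = t).card

/-- The family of probabilities in which, for each `0 ≤ t ≤ n`, the value `|MIS_{G^t}| / |V|^n`
occurs `α_t` times. Here `|MIS_{G^t}|` is the largest cardinality of an MIS of `G^t`. -/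
noncomputable def levelProb {V : Type*} [Fintype V] (G : SimpleGraph V) (n : ℕ)
    (α : Fin (n + 1) → ℕ) : (Σ t : Fin (n + 1), Fin (α t)) → ℝ :=
  fun i => ((orPower G i.1).indepNum : ℝ) / (Fintype.card V : ℝ) ^ n

end CharGraph

namespace CharGraph

open Finset

/-! The entropy bound holds for every proper coloring of `G^n`. Two tuples of the same color cannot
have adjacent letters in any coordinate, so the `k`-th letters of a color class form an independent
set, which extends to an MIS `U_k` depending only on the color. Thus `(X_k, U_k)` is admissible and
`H_G ≤ I(X_k; U_k)`. Since the letters are independent, summing over `k` gives at most `I(X^n; C) ≤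
H(C)`; `sum_mutualInfo_le_entropy` gets this from a single Gibbs inequality.

The MIS structure matters only for the two identities: it fixes the size of each color class by its
level, so sums over colors can be grouped by level. -/

theorem IsAdmissible.sum_eq {V : Type*} [Fintype V] {G : SimpleGraph V} {P : V → ℝ}
    {p : V → Finset V → ℝ} (h : IsAdmissible G P p) : ∑ x, ∑ u, p x u = ∑ x, P x :=
  sum_congr rfl fun x _ => h.marginal x

/-- Mutual information of a probability distribution is nonnegative. -/
theorem mutualInfo_nonneg {A B : Type*} [Fintype A] [Fintype B] {p : A → B → ℝ}
    (h0 : ∀ a b, 0 ≤ p a b) (h1 : ∑ a, ∑ b, p a b = 1) : 0 ≤ mutualInfo p := by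
  -- Termwise form of `1 - 1/t ≤ log t`. The left sides sum to zero, because `p` and the product of
  -- its marginals both have mass one.
  have key : ∀ a b, (p a b - (∑ b', p a b') * (∑ a', p a' b)) / Real.log 2 ≤
      p a b * Real.logb 2 (p a b / ((∑ b', p a b') * (∑ a', p a' b))) := by
    intro a b
    have hl : 0 < Real.log 2 := Real.log_pos one_lt_two
    have hA0 : 0 ≤ ∑ b', p a b' := sum_nonneg fun _ _ => h0 _ _
    have hB0 : 0 ≤ ∑ a', p a' b := sum_nonneg fun _ _ => h0 _ _
    rw [Real.logb, ← mul_div_assoc]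
    refine div_le_div_of_nonneg_right ?_ hl.le
    rcases (h0 a b).eq_or_lt with h | h
    · rw [← h]
      simpa using mul_nonneg hA0 hB0
    · have hA : 0 < ∑ b', p a b' :=
        h.trans_le (single_le_sum (f := fun b' => p a b') (fun _ _ => h0 _ _) (mem_univ b))
      have hB : 0 < ∑ a', p a' b :=
        h.trans_le (single_le_sum (f := fun a' => p a' b) (fun _ _ => h0 _ _) (mem_univ a))
      have h2 := mul_le_mul_of_nonneg_left
        (Real.one_sub_inv_le_log_of_pos (div_pos h (mul_pos hA hB))) h.le
      refine le_trans (le_of_eq ?_) h2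
      field_simp
  refine le_trans (le_of_eq ?_) (sum_le_sum fun a _ => sum_le_sum fun b _ => key a b)
  have hB1 : ∑ b, ∑ a, p a b = 1 := by rw [sum_comm, h1]
  simp_rw [← sum_div, sum_sub_distrib, ← mul_sum, hB1, mul_one, h1, sub_self, zero_div]

theorem sum_uniform (V : Type*) [Fintype V] [Nonempty V] : ∑ x, uniform V x = 1 := by
  simp [uniform]

theorem bddBelow_mutualInfo {V : Type*} [Fintype V] [Nonempty V] (G : SimpleGraph V) :
    BddBelow {I : ℝ | ∃ p, IsAdmissible G (uniform V) p ∧ mutualInfo p = I} := by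
  refine ⟨0, ?_⟩
  rintro _ ⟨p, hp, rfl⟩
  exact mutualInfo_nonneg hp.nonneg (hp.sum_eq.trans (sum_uniform V))

/-- Every independent set of a finite graph lies in a maximal one. -/
theorem exists_isMIS_superset {V : Type*} [Fintype V] (G : SimpleGraph V) {S : Finset V}
    (hS : G.IsIndepSet (S : Set V)) : ∃ U, IsMIS G U ∧ S ⊆ U := by
  classical
  obtain ⟨T, hST, hT⟩ := (Set.toFinite {T : Set V | G.IsIndepSet T}).exists_le_maximal hS
  refine ⟨T.toFinset, ?_, ?_⟩
  · simpa [IsMIS] using hT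
  · intro x hx
    simpa using hST hx

/-- The joint distribution of `(f Y, g Y)` for `Y` uniformly distributed. -/
noncomputable def jointDist {Y A B : Type*} [Fintype Y] [DecidableEq A] [DecidableEq B]
    (f : Y → A) (g : Y → B) : A → B → ℝ :=
  fun a b => ∑ y, if f y = a ∧ g y = b then 1 / (Fintype.card Y : ℝ) else 0

/-! ### Joint laws of functions of a uniform variable -/

section jointDist

variable {Y A B : Type*} [Fintype Y] [DecidableEq A] [DecidableEq B] (f : Y → A) (g : Y → B)

theorem jointDist_nonneg (a : A) (b : B) : 0 ≤ jointDist f g a b :=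
  sum_nonneg fun y _ => by split_ifs <;> positivity

theorem exists_of_jointDist_pos {a : A} {b : B} (h : 0 < jointDist f g a b) :
    ∃ y, f y = a ∧ g y = b := by
  by_contra! hne
  refine h.ne' (sum_eq_zero fun y _ => if_neg fun hy => hne y hy.1 hy.2)

theorem jointDist_pos [Nonempty Y] (y : Y) : 0 < jointDist f g (f y) (g y) := by
  refine lt_of_lt_of_le ?_ (single_le_sum (f := fun z =>
    if f z = f y ∧ g z = g y then 1 / (Fintype.card Y : ℝ) else 0)
    (fun z _ => by split_ifs <;> positivity) (mem_univ y))
  simp [Fintype.card_pos]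

theorem sum_jointDist_right [Fintype B] (a : A) :
    ∑ b, jointDist f g a b = ∑ y, if f y = a then 1 / (Fintype.card Y : ℝ) else 0 := by
  simp_rw [jointDist]
  rw [sum_comm]
  refine sum_congr rfl fun y _ => ?_
  by_cases h : f y = a <;> simp [h]

theorem sum_jointDist_mul [Fintype A] [Fintype B] (F : A → B → ℝ) :
    ∑ a, ∑ b, jointDist f g a b * F a b =
      ∑ y, 1 / (Fintype.card Y : ℝ) * F (f y) (g y) := by
  have h : ∀ a b, jointDist f g a b * F a b = ∑ y, if f y = a then
      (if g y = b then 1 / (Fintype.card Y : ℝ) * F a b else 0) else 0 := by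
    intro a b
    rw [jointDist, sum_mul]
    refine sum_congr rfl fun y _ => ?_
    by_cases h1 : f y = a <;> by_cases h2 : g y = b <;> simp [h1, h2]
  simp_rw [h]
  rw [sum_congr rfl fun a _ => sum_comm, sum_comm]
  refine sum_congr rfl fun y _ => ?_
  rw [Finset.sum_comm]
  simp

end jointDist

/-- Swapping two letters in every coordinate is a bijection between the corresponding fibres of the
`k`-th coordinate, so all these fibres have equal size. -/
theorem sum_ite_apply_eq {V : Type*} [Fintype V] [DecidableEq V] [Nonempty V] {n : ℕ}
    (k : Fin n) (x : V) :
    (∑ y : Fin n → V, if y k = x then 1 / (Fintype.card (Fin n → V) : ℝ) else 0) =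
      uniform V x := by
  have hc : ∀ z, #{y : Fin n → V | y k = z} = #{y : Fin n → V | y k = x} := by
    intro z
    refine card_equiv (Equiv.piCongrRight fun _ => Equiv.swap z x) fun y => ?_
    simp [Equiv.swap_apply_eq_iff]
  have ht : ∑ z, #{y : Fin n → V | y k = z} = Fintype.card (Fin n → V) :=
    (card_eq_sum_card_fiberwise (f := fun y : Fin n → V => y k) (t := univ) (by simp)).symm
  rw [sum_congr rfl fun z _ => hc z, sum_const, card_univ, smul_eq_mul] at ht
  have hp : (Fintype.card V : ℝ) ≠ 0 := by simp
  have hq : (Fintype.card (Fin n → V) : ℝ) ≠ 0 := by simp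
  rw [← sum_filter, sum_const, nsmul_eq_mul, uniform]
  have ht' : (Fintype.card V : ℝ) * #{y : Fin n → V | y k = x} =
    Fintype.card (Fin n → V) := by exact_mod_cast ht
  field_simp
  linarith

theorem colorDist_uniform {V C : Type*} [Fintype V] [DecidableEq C] {n : ℕ}
    (c : (Fin n → V) → C) (k : C) :
    colorDist (uniform V) c k = (#{x | c x = k} : ℝ) / (Fintype.card V : ℝ) ^ n := by
  simp only [colorDist, uniform, prod_const, sum_const, card_univ, Fintype.card_fin, nsmul_eq_mul,
    div_eq_mul_inv, one_mul, inv_pow]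
  congr!

/-- Averaging over tuples instead of colors puts the entropy in the same form as the mutual
informations it is compared with. -/
theorem entropy_colorDist_uniform {V C : Type*} [Fintype V] [Fintype C] [DecidableEq C]
    {n : ℕ} (c : (Fin n → V) → C) :
    entropy (colorDist (uniform V) c) = -∑ y, 1 / (Fintype.card V : ℝ) ^ n *
      Real.logb 2 ((#{x | c x = c y} : ℝ) / (Fintype.card V : ℝ) ^ n) := by
  rw [entropy, ← sum_fiberwise univ c]
  congr 1
  refine sum_congr rfl fun k _ => ?_
  rw [sum_congr rfl (g := fun _ => 1 / (Fintype.card V : ℝ) ^ n *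
      Real.logb 2 ((#{x | c x = k} : ℝ) / (Fintype.card V : ℝ) ^ n)), sum_const, nsmul_eq_mul,
      colorDist_uniform]
  · ring
  · intro y hy
    rw [(mem_filter.1 hy).2]

/-- The letters in one coordinate of a color class of `G^n` lie in a common MIS of `G`. -/
theorem exists_isMIS_of_coloring {V C : Type*} [Fintype V] {G : SimpleGraph V} {n : ℕ}
    (c : (orPower G n).Coloring C) (k : Fin n) (i : C) :
    ∃ U, IsMIS G U ∧ ∀ y, c y = i → y k ∈ U := by
  classical
  have hmem : ∀ a, a ∈ ({a | ∃ y, c y = i ∧ y k = a} : Finset V) ↔ ∃ y, c y = i ∧ y k = a := by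
    simp
  have hS : G.IsIndepSet (({a | ∃ y, c y = i ∧ y k = a} : Finset V) : Set V) := by
    intro a ha b hb _ hadj
    obtain ⟨y, hy, rfl⟩ := (hmem a).1 (mem_coe.1 ha)
    obtain ⟨z, hz, rfl⟩ := (hmem b).1 (mem_coe.1 hb)
    refine c.valid (v := y) (w := z) ⟨?_, k, hadj⟩ (hy.trans hz.symm)
    rintro rfl
    exact G.loopless.irrefl _ hadj
  obtain ⟨U, hU, hSU⟩ := exists_isMIS_superset G hS
  exact ⟨U, hU, fun y hy => hSU ((hmem _).2 ⟨y, hy, rfl⟩)⟩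

/-- Subadditivity of mutual information for independent uniform letters and functions of the
color, together with `I(X^n; C) ≤ H(C)`. -/
theorem sum_mutualInfo_le_entropy {V C B : Type*} [Fintype V] [DecidableEq V] [Nonempty V]
    [Fintype C] [Fintype B] [DecidableEq B] {n : ℕ} (c : (Fin n → V) → C) (U : Fin n → C → B) :
    ∑ k, mutualInfo (jointDist (fun y : Fin n → V => y k) fun y => U k (c y)) ≤
      entropy (colorDist (uniform V) c) := by
  classical
  set p : Fin n → V → B → ℝ :=
    fun k => jointDist (fun y : Fin n → V => y k) fun y => U k (c y) with hp
  have hV : (0 : ℝ) < Fintype.card V := by exact_mod_cast Fintype.card_pos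
  have hN : (Fintype.card (Fin n → V) : ℝ) = (Fintype.card V : ℝ) ^ n := by simp
  have hNpos : (0 : ℝ) < (Fintype.card V : ℝ) ^ n := by positivity
  have hp0 : ∀ k x b, 0 ≤ p k x b := fun k => jointDist_nonneg _ _
  have hpm : ∀ k x, ∑ b, p k x b = uniform V x := fun k x =>
    (sum_jointDist_right _ _ x).trans (sum_ite_apply_eq k x)
  -- the conditional law of the letter given `U`
  set q : Fin n → V → B → ℝ := fun k x b => p k x b / ∑ x', p k x' b with hq
  have hq0 : ∀ k x b, 0 ≤ q k x b := fun k x b =>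
    div_nonneg (hp0 _ _ _) (sum_nonneg fun _ _ => hp0 _ _ _)
  -- Only an inequality: for a value `b` that never occurs, `q` is `0 / 0 = 0`.
  have hq1 : ∀ k b, ∑ x, q k x b ≤ 1 := fun k b => by
    rw [hq, ← sum_div]
    exact div_self_le_one _
  have hppos : ∀ k y, 0 < p k (y k) (U k (c y)) := fun k y =>
    jointDist_pos (fun y : Fin n → V => y k) (fun y => U k (c y)) y
  have hqpos : ∀ k y, 0 < q k (y k) (U k (c y)) := fun k y => by
    refine div_pos (hppos k y) ((hppos k y).trans_le ?_)
    exact single_le_sum (f := fun x => p k x (U k (c y))) (fun _ _ => hp0 _ _ _) (mem_univ _)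
  have hcard : ∀ y, (0 : ℝ) < #{x | c x = c y} := fun y => by
    exact_mod_cast card_pos.2 ⟨y, by simp⟩
  have hI : ∀ k, mutualInfo (p k) = ∑ y : Fin n → V, 1 / (Fintype.card V : ℝ) ^ n *
      Real.logb 2 (Fintype.card V * q k (y k) (U k (c y))) := by
    intro k
    rw [mutualInfo, hp, sum_jointDist_mul, hN]
    refine sum_congr rfl fun y _ => ?_
    have := hpm k (y k)
    rw [hp] at this
    rw [this, uniform, hq]
    congr 2
    simp only [hp]
    rw [one_div, mul_comm (_ : ℝ)⁻¹, ← div_div, div_inv_eq_mul, mul_comm]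
  -- Gibbs' inequality between the uniform law on a color class and the product of the conditional
  -- letter laws `q k`, whose mass on the class is at most one.
  have hgibbs : ∑ y : Fin n → V,
      Real.log (#{x | c x = c y} * ∏ k, q k (y k) (U k (c y))) ≤ 0 := by
    calc _ ≤ ∑ y : Fin n → V, ((#{x | c x = c y} : ℝ) * ∏ k, q k (y k) (U k (c y)) - 1) :=
          sum_le_sum fun y _ => Real.log_le_sub_one_of_pos
            (mul_pos (hcard y) (prod_pos fun k _ => hqpos k y))
      _ = ∑ i : C, (#{x | c x = i} : ℝ) * ∑ y with c y = i, ∏ k, q k (y k) (U k i) -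
            Fintype.card (Fin n → V) := by
          rw [sum_sub_distrib, ← sum_fiberwise univ c]
          congr 1
          · refine sum_congr rfl fun i _ => ?_
            rw [mul_sum]
            refine sum_congr rfl fun y hy => ?_
            rw [(mem_filter.1 hy).2]
          · simp
      _ ≤ ∑ i : C, (#{x | c x = i} : ℝ) * 1 - Fintype.card (Fin n → V) := by
          gcongr with i
          -- Over all tuples, rather than one class, the sum of products factors by coordinate.
          refine (sum_le_sum_of_subset_of_nonneg (subset_univ _) fun y _ _ =>
            prod_nonneg fun k _ => hq0 _ _ _).trans ?_
          rw [← Fintype.prod_sum fun k x => q k x (U k i)]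
          exact prod_le_one (fun k _ => sum_nonneg fun x _ => hq0 _ _ _) fun k _ => hq1 _ _
      _ = 0 := by
          rw [sub_eq_zero]
          simp only [mul_one]
          have := card_eq_sum_card_fiberwise (f := c) (s := univ) (t := univ) (by simp)
          rw [card_univ] at this
          exact_mod_cast this.symm
  have hl : 0 < Real.log 2 := Real.log_pos one_lt_two
  rw [sum_congr rfl fun k _ => hI k, sum_comm, entropy_colorDist_uniform, le_neg_iff_add_nonpos_right,
    ← sum_add_distrib]
  -- The `n` factors `|V|` from the letter laws cancel the `|V|^n` in the color probability.
  have hterm : ∀ y : Fin n → V, (∑ k, 1 / (Fintype.card V : ℝ) ^ n *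
      Real.logb 2 (Fintype.card V * q k (y k) (U k (c y)))) + 1 / (Fintype.card V : ℝ) ^ n *
      Real.logb 2 ((#{x | c x = c y} : ℝ) / (Fintype.card V : ℝ) ^ n) =
      1 / (Fintype.card V : ℝ) ^ n / Real.log 2 *
        Real.log (#{x | c x = c y} * ∏ k, q k (y k) (U k (c y))) := by
    intro y
    rw [← mul_sum, ← mul_add, ← Real.logb_prod _ _ fun k _ => (mul_pos hV (hqpos k y)).ne',
      ← Real.logb_mul (prod_pos fun k _ => mul_pos hV (hqpos k y)).ne'
        (div_pos (hcard y) hNpos).ne', prod_mul_distrib, prod_const, card_univ, Fintype.card_fin,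
      Real.logb, mul_right_comm, mul_div_cancel₀ _ hNpos.ne']
    ring
  rw [sum_congr rfl fun y _ => hterm y, ← mul_sum]
  exact mul_nonpos_of_nonneg_of_nonpos (by positivity) hgibbs

/-- Coloring `G^n` costs at least `n` times the graph entropy. -/
theorem graphEntropy_mul_le_entropy {V C : Type*} [Fintype V] [Nonempty V] [Fintype C]
    {G : SimpleGraph V} {n : ℕ} (c : (orPower G n).Coloring C) :
    n * graphEntropy G (uniform V) ≤ entropy (colorDist (uniform V) c) := by
  classical
  choose U hU hmem using fun k i => exists_isMIS_of_coloring c k i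
  refine le_trans ?_ (sum_mutualInfo_le_entropy c U)
  have h : ∀ k, graphEntropy G (uniform V) ≤
      mutualInfo (jointDist (fun y : Fin n → V => y k) fun y => U k (c y)) := by
    intro k
    refine csInf_le (bddBelow_mutualInfo G) ⟨_, ⟨jointDist_nonneg _ _, fun x => ?_, ?_⟩, rfl⟩
    · exact (sum_jointDist_right _ _ x).trans (sum_ite_apply_eq k x)
    · intro x u h
      obtain ⟨y, rfl, rfl⟩ := exists_of_jointDist_pos _ _ h
      exact ⟨hU _ _, hmem _ _ _ rfl⟩
  calc (n : ℝ) * graphEntropy G (uniform V) = ∑ _k : Fin n, graphEntropy G (uniform V) := by simp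
    _ ≤ _ := sum_le_sum fun k _ => h k

/-! ### Color classes grouped by level -/

namespace MISColoring

variable {V C : Type*} {G : SimpleGraph V} {n : ℕ}

theorem colorDist_eq [Fintype V] (c : MISColoring G n C) (k : C) :
    colorDist (uniform V) c.coloring k =
      ((orPower G (c.level k)).indepNum : ℝ) / (Fintype.card V : ℝ) ^ n := by
  classical
  obtain ⟨e, S, -, hcard, hS⟩ := c.colorClass_eq k
  -- The embedding is injective, so the class has as many elements as `S`.
  have h : ({x | c.coloring x = k} : Finset (Fin n → V)) = S.map e.toEmbedding := by
    rw [← coe_inj, coe_map]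
    simpa [SimpleGraph.Coloring.colorClass] using hS
  rw [colorDist_uniform, h, card_map, hcard]

theorem sum_alpha_mul [Fintype C] (c : MISColoring G n C) (F : Fin (n + 1) → ℝ) :
    ∑ t, (c.alpha t : ℝ) * F t = ∑ k, F (c.level k) := by
  classical
  rw [← sum_fiberwise univ c.level]
  refine sum_congr rfl fun t _ => ?_
  rw [sum_congr rfl (g := fun _ => F t) fun k hk => by rw [(mem_filter.1 hk).2], sum_const,
    nsmul_eq_mul, alpha]

theorem sum_alpha_eq_one [Fintype V] [Fintype C] [Nonempty V] (c : MISColoring G n C) :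
    ∑ t, (c.alpha t : ℝ) *
      (((orPower G t).indepNum : ℝ) / (Fintype.card V : ℝ) ^ n) = 1 := by
  classical
  rw [c.sum_alpha_mul fun t => ((orPower G t).indepNum : ℝ) / (Fintype.card V : ℝ) ^ n]
  simp_rw [← c.colorDist_eq, colorDist_uniform]
  have h := card_eq_sum_card_fiberwise (f := c.coloring) (s := univ) (t := univ) (by simp)
  rw [← sum_div, ← Nat.cast_sum, ← h]
  simp

theorem entropy_colorDist [Fintype V] [Fintype C] (c : MISColoring G n C) :
    entropy (colorDist (uniform V) c.coloring) = entropy (levelProb G n c.alpha) := by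
  rw [entropy, entropy, Fintype.sum_sigma]
  simp only [levelProb, sum_const, card_univ, Fintype.card_fin, nsmul_eq_mul]
  rw [c.sum_alpha_mul fun t => ((orPower G t).indepNum : ℝ) / (Fintype.card V : ℝ) ^ n *
    Real.logb 2 (((orPower G t).indepNum : ℝ) / (Fintype.card V : ℝ) ^ n)]
  simp_rw [c.colorDist_eq]

end MISColoring

end CharGraph

theorem mainTheorem10 {V : Type*} [Fintype V] [Nonempty V] (G : SimpleGraph V)
    (n : ℕ) (hn : 1 ≤ n) {C : Type*} [Fintype C] (c : CharGraph.MISColoring G n C) :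
    (∑ t, (c.alpha t : ℝ) *
        (((CharGraph.orPower G t).indepNum : ℝ) / (Fintype.card V : ℝ) ^ n) = 1) ∧
    CharGraph.entropy (CharGraph.colorDist (CharGraph.uniform V) c.coloring) =
      CharGraph.entropy (CharGraph.levelProb G n c.alpha) ∧
    CharGraph.graphEntropy G (CharGraph.uniform V) ≤
      (1 / n : ℝ) * CharGraph.entropy (CharGraph.levelProb G n c.alpha) := by
  have hn' : (0 : ℝ) < n := by exact_mod_cast hn
  refine ⟨c.sum_alpha_eq_one, c.entropy_colorDist, ?_⟩
  rw [← c.entropy_colorDist, one_div, le_inv_mul_iff₀ hn']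
  exact CharGraph.graphEntropy_mul_le_entropy c.coloring
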